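/- Let $\mathbb T=\mathbb R/\mathbb Z$, let $\alpha_1,\alpha_2\in\mathbb R$ be irrational, and for $n\in\mathbb Z^2$, $x\in\mathbb T^2$ put $T^nx=(x_1+n_1\alpha_1,\;x_2+n_2\alpha_2)$. For a continuous function $f:\mathbb T^2\to\mathbb R$ and $x\in\mathbb T^2$ let $H_x$ be the bounded operator on $\ell^2(\mathbb Z^2)$ given by $$(H_xu)_n=\sum_{|m-n|=1}u_m+f(T^nx)\,u_n,\qquad |m|=|m_1|+|m_2|.$$ A real number is of bounded type if the partial quotients of its continued fraction expansion are bounded. Suppose that $\alpha_1$ and $\alpha_2$ are not both of bounded type, i.e. at least one of them is not of bounded type. Then there is a dense $G_\delta$ set $\mathcal F\subset C(\mathbb T^2,\mathbb R)$ (with respect to the supremum norm) such that for every $f\in\mathcal F$ and for Lebesgue almost every $x\in\mathbb T^2$, the operator $H_x$ has no point spectrum, i.e. no eigenvalues. -/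

import Mathlib

noncomputable section

/-- The torus `(ℝ/ℤ)^d`; its `volume` is the Haar (Lebesgue) probability measure. -/
abbrev Torus (d : ℕ) : Type := Fin d → UnitAddCircle

/-- The complex Hilbert space `ℓ²(ℤ^d)`. -/
abbrev LatticeL2 (d : ℕ) : Type := lp (fun _ : Fin d → ℤ => ℂ) 2

/-- A real number is of bounded type if the partial quotients `a₁, a₂, …` of its continued fraction
expansion are bounded. -/
def BoundedType (a : ℝ) : Prop :=
  ∃ C : ℝ, 0 < C ∧ ∀ (n : ℕ) (b : ℝ), (GenContFract.of a).partDens.get? n = some b → b ≤ C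

/-- `T^n x = (x₁ + n₁ α₁, …, x_d + n_d α_d)` on the torus. -/
def torusShift {d : ℕ} (α : Fin d → ℝ) (n : Fin d → ℤ) (x : Torus d) : Torus d :=
  fun i => x i + (((n i : ℝ) * α i : ℝ) : UnitAddCircle)

/-- Translation `(S_m u)_n = u_{n+m}` as a linear isometry of `ℓ²(ℤ^d)`. -/
def latticeShift {d : ℕ} (m : Fin d → ℤ) : LatticeL2 d →ₗᵢ[ℂ] LatticeL2 d where
  toFun u := ⟨fun n => u (n + m), by
    have h := (lp.memℓp u).summable (by norm_num)
    exact memℓp_gen ((Equiv.addRight m).summable_iff.mpr h)⟩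
  map_add' u v := by ext n; rfl
  map_smul' c u := by ext n; rfl
  norm_map' u := by
    have h2 : (0 : ℝ) < (2 : ENNReal).toReal := by norm_num
    rw [lp.norm_eq_tsum_rpow h2, lp.norm_eq_tsum_rpow h2]
    congr 1
    exact (Equiv.addRight m).tsum_eq (fun n => ‖u n‖ ^ (2 : ENNReal).toReal)

/-- Multiplication by the sequence `n ↦ f (T^n x)`, a bounded operator on `ℓ²(ℤ^d)`. -/
def potentialOp {d : ℕ} (α : Fin d → ℝ) (f : C(Torus d, ℝ)) (x : Torus d) :
    LatticeL2 d →L[ℂ] LatticeL2 d :=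
  lp.mapCLM 2 (fun n => (f (torusShift α n x) : ℂ) • ContinuousLinearMap.id ℂ ℂ)
    (norm_nonneg f) (fun n => by
      refine ContinuousLinearMap.opNorm_le_bound _ (norm_nonneg f) fun z => ?_
      have h := f.norm_coe_le_norm (torusShift α n x)
      simpa using mul_le_mul_of_nonneg_right h (norm_nonneg z))

/-- The Schrödinger operator
`(H_x u)_n = ∑_{|m - n| = 1} u_m + f (T^n x) u_n`, `|m| = ∑ⱼ |mⱼ|`, on `ℓ²(ℤ^d)`. The lattice
neighbours of `n` are written as `n ± e_i`; see `schrodingerOp_apply` for the displayed formula. -/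
def schrodingerOp {d : ℕ} (α : Fin d → ℝ) (f : C(Torus d, ℝ)) (x : Torus d) :
    LatticeL2 d →L[ℂ] LatticeL2 d :=
  ∑ i : Fin d, ((latticeShift (Pi.single i 1)).toContinuousLinearMap +
    (latticeShift (-Pi.single i 1)).toContinuousLinearMap) + potentialOp α f x

theorem schrodingerOp_apply' {d : ℕ} (α : Fin d → ℝ) (f : C(Torus d, ℝ)) (x : Torus d)
    (u : LatticeL2 d) (n : Fin d → ℤ) :
    schrodingerOp α f x u n =
      ∑ i : Fin d, (u (n + Pi.single i 1) + u (n - Pi.single i 1)) +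
        (f (torusShift α n x) : ℂ) * u n := by
  simp only [schrodingerOp, _root_.add_apply, _root_.sum_apply,
    lp.coeFn_add, Pi.add_apply, lp.coeFn_sum, Finset.sum_apply]
  congr 1

theorem abs_sum_eq_one_iff {d : ℕ} (k : Fin d → ℤ) :
    ∑ j, |k j| = 1 ↔ ∃ i, k = Pi.single i 1 ∨ k = -Pi.single i 1 := by
  constructor
  · intro h
    have hne : ∃ i, k i ≠ 0 := by
      by_contra! hc
      simp [hc] at h
    obtain ⟨i, hi⟩ := hne
    have hs := Finset.add_sum_erase Finset.univ (fun j => |k j|) (Finset.mem_univ i)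
    have hnn : 0 ≤ ∑ j ∈ Finset.univ.erase i, |k j| := Finset.sum_nonneg fun j _ => abs_nonneg _
    have h1 : 1 ≤ |k i| := Int.one_le_abs hi
    simp only [h] at hs
    have h0 : ∑ j ∈ Finset.univ.erase i, |k j| = 0 := by omega
    have hi1 : |k i| = 1 := by omega
    rw [Finset.sum_eq_zero_iff_of_nonneg fun j _ => abs_nonneg _] at h0
    have hz : ∀ j, j ≠ i → k j = 0 := fun j hj => by simpa using h0 j (by simp [hj])
    refine ⟨i, ?_⟩
    rcases (abs_eq (by norm_num)).mp hi1 with h' | h'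
    · left
      ext j
      by_cases hj : j = i
      · subst hj; simp [h']
      · simp [hz j hj, hj]
    · right
      ext j
      by_cases hj : j = i
      · subst hj; simp [h']
      · simp [hz j hj, hj]
  · rintro ⟨i, rfl | rfl⟩
    · rw [Finset.sum_eq_single i] <;> simp +contextual
    · rw [Finset.sum_eq_single i] <;> simp +contextual

/-- The displayed formula for `H_x`, with the sum over all `m` with `|m - n| = 1`. -/
theorem schrodingerOp_apply {d : ℕ} (α : Fin d → ℝ) (f : C(Torus d, ℝ)) (x : Torus d)
    (u : LatticeL2 d) (n : Fin d → ℤ) :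
    schrodingerOp α f x u n =
      ∑ᶠ m ∈ {m : Fin d → ℤ | ∑ j, |m j - n j| = 1}, u m +
        (f (torusShift α n x) : ℂ) * u n := by
  classical
  rw [schrodingerOp_apply']
  congr 1
  let e : Fin d × Bool → (Fin d → ℤ) := fun p => n + cond p.2 (Pi.single p.1 1) (-Pi.single p.1 1)
  have hset : {m : Fin d → ℤ | ∑ j, |m j - n j| = 1} = Set.range e := by
    ext m
    have h := abs_sum_eq_one_iff (m - n)
    simp only [Pi.sub_apply] at h
    simp only [Set.mem_ofPred_eq, h, Set.mem_range, Prod.exists, Bool.exists_bool, e, cond]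
    refine exists_congr fun i => ?_
    rw [sub_eq_iff_eq_add', sub_eq_iff_eq_add', or_comm, eq_comm, eq_comm (a := m)]
  have hinj : Function.Injective e := by
    rintro ⟨i, b⟩ ⟨j, c⟩ h
    have h' := add_left_cancel h
    have hi := congrFun h' i
    by_cases hij : i = j
    · subst hij
      cases b <;> cases c <;> simp [cond] at hi ⊢
    · cases b <;> cases c <;> simp [cond, hij] at hi
  rw [hset, finsum_mem_range hinj, finsum_eq_sum_of_fintype, Fintype.sum_prod_type]
  refine Finset.sum_congr rfl fun i _ => ?_
  simp [e, sub_eq_add_neg]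

end

/-!
The proof is a repetition argument in the spirit of Gordon's lemma, adapted to two dimensions.

*Periodic windows.* Suppose that along the orbit of `x` the potential has period `p` in the first
and `q` in the second direction on a window of `J` by `K` periods, and let `u` be an eigenfunction
with `‖u‖ = 1`. The `JK` translates of `u` by the periods solve one and the same equation on a box
with sides `Jp` and `Kq`. A solution on the box is determined by `2 (Jp + Kq)` boundary values, so
the restrictions of the translates to the `JK` lattice points lie in a space of dimension at most
`2 (Jp + Kq)`. The orthogonal projection onto this space has trace equal to its dimension, hence
some lattice point has an evaluation functional of small norm, and the translate of `u` centred
there gives `JK |u 0|² ≤ 2 (Jp + Kq)` (`mul_norm_sq_le_of_periodic_window`). There is no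
concentration of eigenfunctions at the origin if `JK` is large in comparison with `Jp + Kq`.

*Choice of periods.* This needs `J` a large multiple of `q` and `K` a large multiple of `p`, while
the drifts `J ‖p α₀‖` and `K ‖q α₁‖` stay small. If `α₀` is not of bounded type, take `p` with
`p ‖p α₀‖` tiny and `q` from Dirichlet's theorem with a bound of order `p`
(`exists_periods_of_not_boundedType`).

*Density.* Given a continuous `g`, compose it in each coordinate with a measurable map of the
circle close to the identity that corrects the drift after each period. Such a map is read off a
clock, a measurable function on the circle that counts the steps of the rotation for a long time;
it exists because `h α` comes arbitrarily close to a given point modulo one (`exists_clock`,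
`exists_locally_periodic_map`). The new function is uniformly close to `g`, and most of its orbit
potentials are periodic on the window. Continuous functions approximate it almost everywhere.

*Semicontinuity and conclusion.* The set of potentials with an eigenfunction concentrated at the
origin is closed under pointwise convergence (`isClosed_concentratedPotentials`), so the measure of
the points with such an orbit potential is upper semicontinuous under almost everywhere
convergence (`eventually_measure_preimage_lt`). Thus the functions for which this measure is small
form a dense open set, and Baire's theorem yields a dense `Gδ` set of functions for which it is
zero. Translating an eigenfunction moves any site where it does not vanish to the origin, so for
these functions almost no `x` admits an eigenvalue.
-/

open MeasureTheory Filter Topology Set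

/-! ### Continued fractions and rational approximation -/

/-- A continued fraction of a real number has integral continuants. -/
theorem exists_int_contsAux (v : ℝ) (n : ℕ) :
    ∃ a b : ℤ, (GenContFract.of v).contsAux n = ⟨(a : ℝ), (b : ℝ)⟩ := by
  induction n using Nat.strong_induction_on with
  | _ n ih =>
    match n, ih with
    | 0, _ => exact ⟨1, 0, by simp [GenContFract.contsAux]⟩
    | 1, _ => exact ⟨⌊v⌋, 1, by simp [GenContFract.contsAux, GenContFract.of_h_eq_floor]⟩
    | n + 2, ih =>
      obtain ⟨a₀, b₀, h₀⟩ := ih n (by omega)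
      obtain ⟨a₁, b₁, h₁⟩ := ih (n + 1) (by omega)
      cases hs : (GenContFract.of v).s.get? n with
      | none =>
        exact ⟨a₁, b₁, by rw [← h₁]; exact GenContFract.contsAux_stable_step_of_terminated hs⟩
      | some gp =>
        obtain ⟨hgp, z, hz⟩ := GenContFract.of_partNum_eq_one_and_exists_int_partDen_eq hs
        refine ⟨z * a₁ + a₀, z * b₁ + b₀, ?_⟩
        rw [GenContFract.contsAux_recurrence hs h₀ h₁, hgp, hz]
        push_cast
        ring_nf

/-- A real number that is not of bounded type has rational approximations of quality
`o(1 / p²)`, attained along its convergents. -/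
theorem exists_nat_mul_abs_sub_le_of_not_boundedType {a : ℝ} (ha : ¬ BoundedType a) {ε : ℝ}
    (hε : 0 < ε) : ∃ (p : ℕ) (z : ℤ), 1 ≤ p ∧ p * |p * a - z| ≤ ε := by
  unfold BoundedType at ha
  push Not at ha
  obtain ⟨n, b, hb, hbε⟩ := ha (1 / ε) (by positivity)
  obtain ⟨z, q, hzq⟩ := exists_int_contsAux a (n + 1)
  have hconv := GenContFract.abs_sub_convergents_le' hb
  have hnum : (GenContFract.of a).nums n = z := by
    rw [GenContFract.num_eq_conts_a, GenContFract.nth_cont_eq_succ_nth_contAux, hzq]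
  have hden : (GenContFract.of a).dens n = q := by
    rw [GenContFract.den_eq_conts_b, GenContFract.nth_cont_eq_succ_nth_contAux, hzq]
  have hpos : ∀ k, (1 : ℝ) ≤ (GenContFract.of a).dens k := by
    intro k
    induction k with
    | zero => simp [GenContFract.zeroth_den_eq_one]
    | succ k ih => exact ih.trans GenContFract.of_den_mono
  have hq : (1 : ℝ) ≤ q := hden ▸ hpos n
  have hq' : 1 ≤ q := by exact_mod_cast hq
  rw [GenContFract.conv_eq_num_div_den, hnum, hden] at hconv
  have hb0 : 0 < b := lt_trans (by positivity) hbε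
  lift q to ℕ using by omega
  refine ⟨q, z, by omega, ?_⟩
  push_cast at hq hconv ⊢
  have hq0 : (0 : ℝ) < q := by linarith
  have h1 : (q : ℝ) * |q * a - z| = q * q * |a - z / q| := by
    have : (q : ℝ) * a - z = q * (a - z / q) := by field_simp
    rw [this, abs_mul, abs_of_pos hq0]
    ring
  rw [h1]
  calc (q : ℝ) * q * |a - z / q| ≤ q * q * (1 / (b * q * q)) := by gcongr
    _ = 1 / b := by field_simp
    _ ≤ ε := by rw [div_le_comm₀ hb0 hε]; exact hbε.le

/-! ### Spaces of small dimension -/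

/-- A subspace of `ℂ^ι` of dimension `d` has a coordinate functional of squared norm at most
`d / |ι|`: the squared norms of all coordinate functionals add up to the trace of the orthogonal
projection onto the subspace. -/
theorem exists_coord_norm_sq_le {ι : Type*} [Fintype ι] [Nonempty ι]
    (W : Submodule ℂ (EuclideanSpace ℂ ι)) :
    ∃ i, ∀ y ∈ W, (Fintype.card ι : ℝ) * ‖y i‖ ^ 2 ≤ Module.finrank ℂ W * ‖y‖ ^ 2 := by
  let e := stdOrthonormalBasis ℂ W
  have hsum : ∑ i : ι, ∑ k, ‖(e k : EuclideanSpace ℂ ι) i‖ ^ 2 = Module.finrank ℂ W := by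
    rw [Finset.sum_comm]
    have : ∀ k, ∑ i : ι, ‖(e k : EuclideanSpace ℂ ι) i‖ ^ 2 = 1 := fun k => by
      rw [← EuclideanSpace.norm_sq_eq]
      have h1 : ‖e k‖ = 1 := e.orthonormal.1 k
      rw [Submodule.norm_coe, h1, one_pow]
    simp [this]
  obtain ⟨i, -, hi⟩ := Finset.exists_min_image (Finset.univ : Finset ι)
    (fun i => ∑ k, ‖(e k : EuclideanSpace ℂ ι) i‖ ^ 2) Finset.univ_nonempty
  refine ⟨i, fun y hy => ?_⟩
  have hcard : (Fintype.card ι : ℝ) * ∑ k, ‖(e k : EuclideanSpace ℂ ι) i‖ ^ 2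
      ≤ Module.finrank ℂ W := by
    rw [← hsum, ← nsmul_eq_mul]
    exact Finset.card_nsmul_le_sum _ _ _ fun j hj => hi j hj
  have hy_eq : y i = ∑ k, e.repr ⟨y, hy⟩ k * (e k : EuclideanSpace ℂ ι) i := by
    have h := congrArg (fun w : W => (w : EuclideanSpace ℂ ι) i) (e.sum_repr ⟨y, hy⟩)
    simp only at h
    rw [← h]
    simp
  have hyn : ∑ k, ‖e.repr ⟨y, hy⟩ k‖ ^ 2 = ‖y‖ ^ 2 := by
    rw [← EuclideanSpace.norm_sq_eq, e.repr.norm_map]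
    rfl
  have hcs : ‖y i‖ ^ 2 ≤ ‖y‖ ^ 2 * ∑ k, ‖(e k : EuclideanSpace ℂ ι) i‖ ^ 2 := by
    rw [hy_eq, ← hyn]
    calc _ ≤ (∑ k, ‖e.repr ⟨y, hy⟩ k‖ * ‖(e k : EuclideanSpace ℂ ι) i‖) ^ 2 := by
            gcongr
            exact (norm_sum_le _ _).trans (by simp)
      _ ≤ _ := Finset.sum_mul_sq_le_sq_mul_sq _ _ _
  calc (Fintype.card ι : ℝ) * ‖y i‖ ^ 2
      ≤ Fintype.card ι * (‖y‖ ^ 2 * ∑ k, ‖(e k : EuclideanSpace ℂ ι) i‖ ^ 2) := by gcongr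
    _ = (Fintype.card ι * ∑ k, ‖(e k : EuclideanSpace ℂ ι) i‖ ^ 2) * ‖y‖ ^ 2 := by ring
    _ ≤ _ := by gcongr

/-- If `g` vanishes wherever `f` does, the range of `g` is at most as large as that of `f`. -/
theorem finrank_range_le_of_ker_le {V V₁ V₂ : Type*} [AddCommGroup V] [Module ℂ V]
    [AddCommGroup V₁] [Module ℂ V₁] [AddCommGroup V₂] [Module ℂ V₂] [FiniteDimensional ℂ V₁]
    (f : V →ₗ[ℂ] V₁) (g : V →ₗ[ℂ] V₂) (h : LinearMap.ker f ≤ LinearMap.ker g) :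
    Module.finrank ℂ (LinearMap.range g) ≤ Module.finrank ℂ V₁ := by
  let G : LinearMap.range f →ₗ[ℂ] V₂ :=
    (LinearMap.ker f).liftQ g h ∘ₗ f.quotKerEquivRange.symm.toLinearMap
  have hG : LinearMap.range g ≤ LinearMap.range G := by
    rintro _ ⟨v, rfl⟩
    refine ⟨⟨f v, v, rfl⟩, ?_⟩
    have : f.quotKerEquivRange.symm ⟨f v, v, rfl⟩ = Submodule.Quotient.mk v :=
      f.quotKerEquivRange_symm_apply_image v _
    simp [G, this]
  exact (Submodule.finrank_mono hG).trans
    ((LinearMap.finrank_range_le G).trans (Submodule.finrank_le _))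

/-! ### Periodic windows -/

/-- The functions on `ℤ²` that satisfy the eigenvalue equation with potential `V` at the interior
sites of the box `[0, a) × [0, b)`. -/
def boxSolutions (a b : ℕ) (V : ℤ → ℤ → ℂ) (E : ℂ) : Submodule ℂ (ℤ → ℤ → ℂ) where
  carrier := {y | ∀ s t : ℤ, 0 < s → s + 1 < a → 0 < t → t + 1 < b →
    y (s + 1) t + y (s - 1) t + (y s (t + 1) + y s (t - 1)) + V s t * y s t = E * y s t}
  add_mem' {y z} hy hz s t h₁ h₂ h₃ h₄ := by
    have e₁ := hy s t h₁ h₂ h₃ h₄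
    have e₂ := hz s t h₁ h₂ h₃ h₄
    simp only [Pi.add_apply]
    linear_combination e₁ + e₂
  zero_mem' s t _ _ _ _ := by simp
  smul_mem' c y hy s t h₁ h₂ h₃ h₄ := by
    have e₁ := hy s t h₁ h₂ h₃ h₄
    simp only [Pi.smul_apply, smul_eq_mul]
    linear_combination c * e₁

/-- A solution on a box that vanishes on the two leftmost columns and on the bottom and top rows
vanishes on the whole box: the equation determines each column from the two before it. -/
theorem boxSolutions_eq_zero {a b : ℕ} {V : ℤ → ℤ → ℂ} {E : ℂ} {y : ℤ → ℤ → ℂ}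
    (hy : y ∈ boxSolutions a b V E)
    (hcol : ∀ i : Fin 2, ∀ k : Fin b, y (i : ℕ) (k : ℕ) = 0)
    (hrow : ∀ i : Fin 2, ∀ k : Fin a, y (k : ℕ) ((i : ℕ) * ((b : ℤ) - 1)) = 0) (s t : ℕ)
    (hs : s < a) (ht : t < b) : y s t = 0 := by
  induction s using Nat.strong_induction_on generalizing t with
  | _ s ih =>
    match s, ih, hs with
    | 0, _, _ => simpa using hcol 0 ⟨t, ht⟩
    | 1, _, _ => simpa using hcol 1 ⟨t, ht⟩
    | s + 2, ih, hs =>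
      rcases Nat.eq_zero_or_pos t with rfl | ht0
      · simpa using hrow 0 ⟨s + 2, hs⟩
      rcases Nat.lt_or_ge (t + 1) b with htb | htb
      · have h := hy ((s + 1 : ℕ) : ℤ) (t : ℤ) (by omega) (by omega) (by omega) (by omega)
        obtain ⟨t', rfl⟩ : ∃ t', t = t' + 1 := ⟨t - 1, by omega⟩
        have e₁ := ih (s + 1) (by omega) (t' + 1) (by omega) ht
        have e₂ := ih s (by omega) (t' + 1) (by omega) ht
        have e₃ := ih (s + 1) (by omega) (t' + 2) (by omega) htb
        have e₄ := ih (s + 1) (by omega) t' (by omega) (by omega)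
        have c₁ : ((s + 1 : ℕ) : ℤ) + 1 = ((s + 2 : ℕ) : ℤ) := by push_cast; ring
        have c₂ : ((s + 1 : ℕ) : ℤ) - 1 = (s : ℤ) := by push_cast; ring
        have c₃ : ((t' + 1 : ℕ) : ℤ) + 1 = ((t' + 2 : ℕ) : ℤ) := by push_cast; ring
        have c₄ : ((t' + 1 : ℕ) : ℤ) - 1 = (t' : ℤ) := by push_cast; ring
        rw [c₁, c₂, c₃, c₄, e₁, e₂, e₃, e₄] at h
        simpa using h
      · have := hrow 1 ⟨s + 2, hs⟩
        have c : ((1 : Fin 2) : ℕ) * ((b : ℤ) - 1) = t := by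
          have : t + 1 = b := by omega
          simp [← this]
        rwa [c] at this

/-- Iterating a one-step period inside a window. -/
theorem apply_sub_mul_eq_of_periodic_window {p J : ℕ} {v : ℤ → ℂ}
    (hv : ∀ s : ℤ, -(J * p : ℤ) ≤ s → s + p ≤ J * p → v (s + p) = v s) {s : ℤ} (hs : 0 ≤ s)
    (hs' : s ≤ J * p) (j : ℕ) (hj : j ≤ J) : v (s - j * p) = v s := by
  induction j with
  | zero => simp
  | succ j ih =>
    rw [← ih (by omega)]
    have hjp : ((j + 1 : ℕ) : ℤ) * p ≤ J * p := by gcongr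
    have hjp' : 0 ≤ (j : ℤ) * p := by positivity
    push_cast at hjp ⊢
    have e : s - j * p = (s - (j + 1) * p) + p := by ring
    rw [e]
    refine (hv _ ?_ ?_).symm <;> linarith

/-- **Periodic windows exclude concentration.** If the potential has periods `p` and `q` in the two
coordinate directions on a window of `J` by `K` periods, then a normalised eigenfunction carries at
most the fraction `2 (Jp + Kq) / (JK)` of its mass at the origin. Indeed the translates of the
eigenfunction by the periods solve one and the same equation on a box, whose solution space has
dimension at most its boundary length `2 (Jp + Kq)`; hence their restrictions to the `JK` lattice
points in the box lie in a space of that dimension, and on it the evaluation at some lattice point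
has small norm. -/
theorem mul_norm_sq_le_of_periodic_window {p q J K : ℕ} (hp : 0 < p) (hq : 0 < q) (hJ : 0 < J)
    (hK : 0 < K) {V u : ℤ → ℤ → ℂ} {E : ℂ}
    (hu : ∀ s t, u (s + 1) t + u (s - 1) t + (u s (t + 1) + u s (t - 1)) + V s t * u s t
      = E * u s t)
    (hV₁ : ∀ s t : ℤ, -(J * p : ℤ) ≤ s → s + p ≤ J * p → V (s + p) t = V s t)
    (hV₂ : ∀ s t : ℤ, -(K * q : ℤ) ≤ t → t + q ≤ K * q → V s (t + q) = V s t)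
    (hn : ∀ F : Finset (ℤ × ℤ), ∑ i ∈ F, ‖u i.1 i.2‖ ^ 2 ≤ 1) :
    (J * K : ℝ) * ‖u 0 0‖ ^ 2 ≤ 2 * (J * p + K * q) := by
  have : NeZero J := ⟨hJ.ne'⟩
  have : NeZero K := ⟨hK.ne'⟩
  let S := boxSolutions (J * p) (K * q) V E
  let ι := Fin J × Fin K
  let g : S →ₗ[ℂ] EuclideanSpace ℂ ι :=
    { toFun y := WithLp.toLp 2 fun i => (y : ℤ → ℤ → ℂ) (i.1 * p) (i.2 * q)
      map_add' _ _ := rfl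
      map_smul' _ _ := rfl }
  let f : S →ₗ[ℂ] (Fin 2 × Fin (K * q) ⊕ Fin 2 × Fin (J * p) → ℂ) :=
    { toFun y := Sum.elim (fun i => (y : ℤ → ℤ → ℂ) (i.1 : ℕ) (i.2 : ℕ))
        (fun i => (y : ℤ → ℤ → ℂ) (i.2 : ℕ) ((i.1 : ℕ) * (((K * q : ℕ) : ℤ) - 1)))
      map_add' _ _ := by ext (i | i) <;> rfl
      map_smul' _ _ := by ext (i | i) <;> rfl }
  have hg : ∀ (y : S) (i : ι), g y i = (y : ℤ → ℤ → ℂ) (i.1 * p) (i.2 * q) := fun _ _ => rfl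
  have hker : LinearMap.ker f ≤ LinearMap.ker g := by
    intro y hy
    rw [LinearMap.mem_ker] at hy ⊢
    ext i
    have h := boxSolutions_eq_zero y.2 (fun i k => congrFun hy (Sum.inl (i, k)))
      (fun i k => congrFun hy (Sum.inr (i, k))) (i.1 * p) (i.2 * q)
      (Nat.mul_lt_mul_of_pos_right i.1.2 hp) (Nat.mul_lt_mul_of_pos_right i.2.2 hq)
    rw [hg]
    simpa using h
  have hrank : (Module.finrank ℂ (LinearMap.range g) : ℝ) ≤ 2 * (J * p + K * q) := by
    have h := finrank_range_le_of_ker_le f g hker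
    rw [Module.finrank_fintype_fun_eq_card] at h
    simp only [Fintype.card_sum, Fintype.card_prod, Fintype.card_fin] at h
    calc (Module.finrank ℂ (LinearMap.range g) : ℝ)
        ≤ ((2 * (K * q) + 2 * (J * p) : ℕ) : ℝ) := by exact_mod_cast h
      _ = _ := by push_cast; ring
  obtain ⟨i, hi⟩ := exists_coord_norm_sq_le (LinearMap.range g)
  -- the translate of `u` that moves the origin to the lattice point with index `i`
  let y : ℤ → ℤ → ℂ := fun s t => u (s - i.1 * p) (t - i.2 * q)
  have hyS : y ∈ S := by
    intro s t hs hs' ht ht'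
    have h := hu (s - i.1 * p) (t - i.2 * q)
    push_cast at hs' ht'
    have e₁ : V (s - i.1 * p) (t - i.2 * q) = V s t := by
      rw [apply_sub_mul_eq_of_periodic_window (v := fun s => V s (t - i.2 * q))
        (fun s => hV₁ s _) hs.le (by linarith) _ i.1.2.le,
        apply_sub_mul_eq_of_periodic_window (v := fun t => V s t)
        (fun t => hV₂ s t) ht.le (by linarith) _ i.2.2.le]
    rw [e₁] at h
    simp only [y]
    rw [← h, show s + 1 - i.1 * (p : ℤ) = s - i.1 * p + 1 by ring,
      show s - 1 - i.1 * (p : ℤ) = s - i.1 * p - 1 by ring,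
      show t + 1 - i.2 * (q : ℤ) = t - i.2 * q + 1 by ring,
      show t - 1 - i.2 * (q : ℤ) = t - i.2 * q - 1 by ring]
  have h := hi (g ⟨y, hyS⟩) ⟨_, rfl⟩
  have hyi : g ⟨y, hyS⟩ i = u 0 0 := by rw [hg]; simp [y]
  have hyn : ‖g ⟨y, hyS⟩‖ ^ 2 ≤ 1 := by
    rw [EuclideanSpace.norm_sq_eq]
    let φ : ι ↪ ℤ × ℤ :=
      ⟨fun k => (k.1 * p - i.1 * p, k.2 * q - i.2 * q), fun k l hkl => by
        have h₁ := congrArg Prod.fst hkl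
        have h₂ := congrArg Prod.snd hkl
        simp only at h₁ h₂
        have hp' : (p : ℤ) ≠ 0 := by omega
        have hq' : (q : ℤ) ≠ 0 := by omega
        have h₁' : ((k.1 : ℕ) : ℤ) = (l.1 : ℕ) := mul_right_cancel₀ hp' (by linarith)
        have h₂' : ((k.2 : ℕ) : ℤ) = (l.2 : ℕ) := mul_right_cancel₀ hq' (by linarith)
        exact Prod.ext (Fin.ext (by exact_mod_cast h₁')) (Fin.ext (by exact_mod_cast h₂'))⟩
    have h := hn (Finset.univ.map φ)
    rw [Finset.sum_map] at h
    exact h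
  rw [hyi, Fintype.card_prod, Fintype.card_fin, Fintype.card_fin] at h
  push_cast at h
  calc (J * K : ℝ) * ‖u 0 0‖ ^ 2 ≤ _ := h
    _ ≤ Module.finrank ℂ (LinearMap.range g) * 1 := by gcongr
    _ ≤ _ := by rwa [mul_one]

/-! ### Concentrated potentials -/

/-- The lattice operator `u ↦ (n ↦ ∑ᵢ (u (n + eᵢ) + u (n - eᵢ)) + V n u n)` on arbitrary functions
on `ℤ²`. -/
noncomputable def latticeOp (V : (Fin 2 → ℤ) → ℝ) (u : (Fin 2 → ℤ) → ℂ) (n : Fin 2 → ℤ) : ℂ :=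
  ∑ i : Fin 2, (u (n + Pi.single i 1) + u (n - Pi.single i 1)) + (V n : ℂ) * u n

/-- The potentials on `ℤ²` that have an eigenfunction of `ℓ²`-norm at most one whose value at the
origin has squared modulus at least `c`. For `c > 0` the eigenvalue must be
`latticeOp V u 0 / u 0`; the eigenvalue equation is multiplied by `u 0` so as not to mention it. -/
def concentratedPotentials (c : ℝ) : Set ((Fin 2 → ℤ) → ℝ) :=
  {V | ∃ u : (Fin 2 → ℤ) → ℂ, (∀ F : Finset (Fin 2 → ℤ), ∑ n ∈ F, ‖u n‖ ^ 2 ≤ 1) ∧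
    c ≤ ‖u 0‖ ^ 2 ∧ ∀ n, u 0 * latticeOp V u n = latticeOp V u 0 * u n}

/-- Concentration persists under pointwise limits of potentials, because the unit ball of `ℓ²` is
compact for pointwise convergence. -/
theorem isClosed_concentratedPotentials (c : ℝ) : IsClosed (concentratedPotentials c) := by
  let K := (Fin 2 → ℤ) → Metric.closedBall (0 : ℂ) 1
  let T : Set (((Fin 2 → ℤ) → ℝ) × K) :=
    {x | (∀ F : Finset (Fin 2 → ℤ), ∑ n ∈ F, ‖(x.2 n : ℂ)‖ ^ 2 ≤ 1) ∧ c ≤ ‖(x.2 0 : ℂ)‖ ^ 2 ∧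
      ∀ n, (x.2 0 : ℂ) * latticeOp x.1 (fun m => x.2 m) n
        = latticeOp x.1 (fun m => x.2 m) 0 * x.2 n}
  have hev : ∀ n, Continuous fun x : ((Fin 2 → ℤ) → ℝ) × K => (x.2 n : ℂ) := fun n => by fun_prop
  have hop : ∀ n, Continuous fun x : ((Fin 2 → ℤ) → ℝ) × K =>
      latticeOp x.1 (fun m => x.2 m) n := fun n => by
    unfold latticeOp
    fun_prop
  have hT : IsClosed T := by
    have h : T = (⋂ F : Finset (Fin 2 → ℤ), {x | ∑ n ∈ F, ‖(x.2 n : ℂ)‖ ^ 2 ≤ 1}) ∩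
        ({x | c ≤ ‖(x.2 0 : ℂ)‖ ^ 2} ∩ ⋂ n, {x | (x.2 0 : ℂ) * latticeOp x.1 (fun m => x.2 m) n
          = latticeOp x.1 (fun m => x.2 m) 0 * x.2 n}) := by
      ext x
      simp [T]
    rw [h]
    refine (isClosed_iInter fun F => ?_).inter (IsClosed.inter ?_ (isClosed_iInter fun n => ?_))
    · exact isClosed_le (continuous_finsetSum _ fun n _ => (hev n).norm.pow 2) continuous_const
    · exact isClosed_le continuous_const ((hev 0).norm.pow 2)
    · exact isClosed_eq ((hev 0).mul (hop n)) ((hop 0).mul (hev n))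
  have himg : concentratedPotentials c = Prod.fst '' T := by
    ext V
    constructor
    · rintro ⟨u, hu, hc, he⟩
      refine ⟨(V, fun n => ⟨u n, ?_⟩), ⟨hu, hc, he⟩, rfl⟩
      have := hu {n}
      rw [Finset.sum_singleton, sq_le_one_iff₀ (norm_nonneg _)] at this
      simpa using this
    · rintro ⟨⟨V, u⟩, ⟨hu, hc, he⟩, rfl⟩
      exact ⟨fun n => u n, hu, hc, he⟩
  rw [himg]
  exact isClosedMap_fst_of_compactSpace _ hT

/-- For almost everywhere convergent measurable random points, the probability of a closed set is
upper semicontinuous. -/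
theorem eventually_measure_preimage_lt {Ω E : Type*} [MeasurableSpace Ω] {μ : Measure Ω}
    [IsFiniteMeasure μ] [TopologicalSpace E] [MeasurableSpace E] [OpensMeasurableSpace E]
    {X : ℕ → Ω → E} {Y : Ω → E} (hX : ∀ k, Measurable (X k))
    (hlim : ∀ᵐ ω ∂μ, Tendsto (fun k => X k ω) atTop (𝓝 (Y ω))) {Z : Set E} (hZ : IsClosed Z)
    {ε : ENNReal} (hε : μ (Y ⁻¹' Z) < ε) : ∀ᶠ k in atTop, μ (X k ⁻¹' Z) < ε := by
  let A : ℕ → Set Ω := fun k => ⋃ j ≥ k, X j ⁻¹' Z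
  have hAm : ∀ k, MeasurableSet (A k) := fun k =>
    MeasurableSet.iUnion fun j => MeasurableSet.iUnion fun _ => hX j hZ.measurableSet
  have hanti : Antitone A := fun k l hkl =>
    iUnion_mono fun j => iUnion_mono' fun hj => ⟨hkl.trans hj, subset_rfl⟩
  have hsub : (⋂ k, A k : Set Ω) ≤ᵐ[μ] Y ⁻¹' Z := by
    filter_upwards [hlim] with ω hω hmem
    by_contra hc
    obtain ⟨k, hk⟩ := (hω.eventually (hZ.isOpen_compl.mem_nhds hc)).exists_forall_of_atTop
    obtain ⟨j, hj, hjZ⟩ : ∃ j ≥ k, X j ω ∈ Z := by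
      simpa [A] using mem_iInter.mp hmem k
    exact hk j hj hjZ
  have ht := tendsto_measure_iInter_atTop (μ := μ) (fun k => (hAm k).nullMeasurableSet) hanti
    ⟨0, measure_ne_top _ _⟩
  filter_upwards [ht.eventually_lt_const ((measure_mono_ae hsub).trans_lt hε)] with k hk
  exact (measure_mono fun ω hω => mem_iUnion₂.mpr ⟨k, le_rfl, hω⟩).trans_lt hk

/-! ### Clocks for irrational rotations -/

/-- The representative in `[0, 1)` of a point of the circle. -/
noncomputable def circleFract (t : UnitAddCircle) : ℝ := (AddCircle.equivIco 1 0 t : ℝ)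

theorem circleFract_mem (t : UnitAddCircle) : circleFract t ∈ Ico (0 : ℝ) 1 := by
  simpa [circleFract] using (AddCircle.equivIco 1 0 t).2

theorem coe_circleFract (t : UnitAddCircle) : ((circleFract t : ℝ) : UnitAddCircle) = t :=
  AddCircle.coe_equivIco

theorem circleFract_coe {x : ℝ} (hx : x ∈ Ico (0 : ℝ) 1) :
    circleFract (x : UnitAddCircle) = x := by
  have hx' : x ∈ Ico (0 : ℝ) (0 + 1) := by simpa using hx
  rw [circleFract, AddCircle.equivIco_coe_eq hx']

theorem measurable_circleFract : Measurable circleFract :=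
  measurable_subtype_coe.comp (AddCircle.measurableEquivIco 1 0).measurable

theorem coe_intCast_unitAddCircle (z : ℤ) : ((z : ℝ) : UnitAddCircle) = 0 := by
  rw [AddCircle.coe_eq_zero_iff]
  exact ⟨z, by simp⟩

/-- Multiples of an irrational number approximate `1 / R` modulo one. -/
theorem exists_zsmul_eq_inv_add {a : ℝ} (ha : Irrational a) {R : ℕ} (hR : 2 ≤ R) {η : ℝ}
    (hη : 0 < η) : ∃ (h : ℤ) (e : ℝ), h ≠ 0 ∧ |e| < η ∧
      h • (a : UnitAddCircle) = ((1 / R + e : ℝ) : UnitAddCircle) := by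
  have hR' : (2 : ℝ) ≤ R := by exact_mod_cast hR
  have hR0 : (0 : ℝ) < R := by linarith
  have hd : DenseRange (fun h : ℤ => h • (a : UnitAddCircle)) :=
    (AddCircle.denseRange_zsmul_coe_iff (p := 1)).mpr (by simpa using ha)
  obtain ⟨h, hh⟩ := Metric.denseRange_iff.mp hd ((1 / R : ℝ) : UnitAddCircle)
    (min η (1 / (2 * R))) (by positivity)
  rw [dist_comm, dist_eq_norm, ← AddCircle.coe_zsmul, ← AddCircle.coe_sub,
    UnitAddCircle.norm_eq] at hh
  set x : ℝ := h • a - 1 / R with hx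
  have he : h • (a : UnitAddCircle) = ((1 / R + (x - round x) : ℝ) : UnitAddCircle) := by
    have : (h • a : ℝ) = 1 / R + (x - round x) + (round x : ℤ) := by rw [hx]; ring
    rw [← AddCircle.coe_zsmul, this, AddCircle.coe_add _ (1 / R + (x - round x)),
      coe_intCast_unitAddCircle, add_zero]
  refine ⟨h, x - round x, ?_, hh.trans_le (min_le_left _ _), he⟩
  rintro rfl
  have h2 := abs_lt.mp (hh.trans_le (min_le_right _ _))
  have hR1 : 1 / (2 * (R : ℝ)) < 1 / R := by
    apply one_div_lt_one_div_of_lt hR0; linarith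
  have hR2 : 1 / (2 * (R : ℝ)) + 1 / R < 1 := by
    rw [div_add_div _ _ (by positivity) (by positivity), div_lt_one (by positivity)]
    nlinarith
  have h3 := circleFract_coe (x := 1 / R + (x - round x)) ⟨by linarith, by linarith⟩
  rw [← he, zero_zsmul] at h3
  have h4 := circleFract_coe (x := 0) ⟨le_rfl, one_pos⟩
  rw [AddCircle.coe_zero] at h4
  rw [h4] at h3
  linarith

/-- The points of the circle that lie, on the scale `1 / R`, within distance `M` of the origin or
within distance `ρ` of the grid. -/
def nearGrid (M R : ℕ) (ρ : ℝ) : Set UnitAddCircle :=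
  {s | R * circleFract s < M ∨ R - M ≤ R * circleFract s ∨
    ∃ j ∈ Finset.range (R + 1), |R * circleFract s - j| < ρ}

theorem measurableSet_nearGrid (M R : ℕ) (ρ : ℝ) : MeasurableSet (nearGrid M R ρ) := by
  have hm : Measurable fun s => R * circleFract s := measurable_circleFract.const_mul _
  have h : nearGrid M R ρ = {s | R * circleFract s < M} ∪ ({s | R - M ≤ R * circleFract s} ∪
      ⋃ j ∈ Finset.range (R + 1), {s | |R * circleFract s - j| < ρ}) := by
    ext s
    simp [nearGrid]
  rw [h]
  refine (measurableSet_lt hm measurable_const).union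
    ((measurableSet_le measurable_const hm).union
      (Finset.measurableSet_biUnion _ fun j _ => measurableSet_lt ?_ measurable_const))
  exact (hm.sub_const _).abs

theorem volume_nearGrid_le {M R : ℕ} (hR : 0 < R) {ρ : ℝ} (hρ : 0 < ρ) :
    volume (nearGrid M R ρ) ≤ ENNReal.ofReal (2 * M / R + (R + 1) * (2 * ρ / R)) := by
  have hR0 : (0 : ℝ) < R := by exact_mod_cast hR
  rw [AddCircle.add_projection_respects_measure 1 0 (measurableSet_nearGrid M R ρ)]
  have hsub : QuotientAddGroup.mk ⁻¹' nearGrid M R ρ ∩ Ioc (0 : ℝ) (0 + 1) ⊆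
      Icc (0 : ℝ) (M / R) ∪ (Icc (1 - M / R : ℝ) 1 ∪
        ⋃ j ∈ Finset.range (R + 1), Ioo ((j - ρ) / R : ℝ) ((j + ρ) / R)) := by
    rintro x ⟨hx, hx0, hx1⟩
    rw [zero_add] at hx1
    have hMR : (0 : ℝ) ≤ M / R := by positivity
    rcases hx1.eq_or_lt with rfl | hx1'
    · exact Or.inr (Or.inl ⟨by linarith, le_rfl⟩)
    have hf : circleFract (QuotientAddGroup.mk x) = x := circleFract_coe ⟨hx0.le, hx1'⟩
    simp only [mem_preimage, nearGrid, mem_ofPred_eq, hf] at hx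
    rcases hx with h | h | ⟨j, hj, h⟩
    · exact Or.inl ⟨hx0.le, by rw [le_div_iff₀ hR0]; linarith⟩
    · refine Or.inr (Or.inl ⟨?_, hx1⟩)
      have h' : (1 - x) * R ≤ M := by linarith
      rw [← le_div_iff₀ hR0] at h'
      linarith
    · refine Or.inr (Or.inr (mem_iUnion₂.mpr ⟨j, hj, ?_⟩))
      rw [abs_lt] at h
      constructor
      · rw [div_lt_iff₀ hR0]; linarith
      · rw [lt_div_iff₀ hR0]; linarith
  refine (measure_mono hsub).trans ((measure_union_le _ _).trans ?_)
  have h₁ : volume (Icc (0 : ℝ) (M / R)) = ENNReal.ofReal (M / R) := by simp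
  have h₂ : volume (Icc (1 - M / R : ℝ) 1) = ENNReal.ofReal (M / R) := by simp
  have h₃ : volume (⋃ j ∈ Finset.range (R + 1), Ioo ((j - ρ) / R : ℝ) ((j + ρ) / R))
      ≤ ENNReal.ofReal ((R + 1) * (2 * ρ / R)) := by
    refine (measure_biUnion_finset_le _ _).trans ?_
    have : ∀ j ∈ Finset.range (R + 1), volume (Ioo ((j - ρ) / R : ℝ) ((j + ρ) / R))
        = ENNReal.ofReal (2 * ρ / R) := fun j _ => by
      rw [Real.volume_Ioo]; congr 1; ring
    rw [Finset.sum_congr rfl this, Finset.sum_const, Finset.card_range, nsmul_eq_mul,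
      ENNReal.ofReal_mul (by positivity)]
    gcongr
    rw [← Nat.cast_succ, ENNReal.ofReal_natCast]
  calc _ ≤ ENNReal.ofReal (M / R) + (ENNReal.ofReal (M / R)
        + ENNReal.ofReal ((R + 1) * (2 * ρ / R))) := by
          rw [h₁]
          gcongr
          exact (measure_union_le _ _).trans (by rw [h₂]; gcongr)
    _ = _ := by
          rw [← ENNReal.ofReal_add (by positivity) (by positivity),
            ← ENNReal.ofReal_add (by positivity) (by positivity)]
          congr 1; ring

/-- **A clock for an irrational rotation.** There is a function on the circle with values in
`{0, …, R - 1}` that advances by one under the rotation by `a`, for all times up to `M` in both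
directions, off a set of measure little more than `2M / R`. It reads off the position of `h t` on a
dial with `R` marks, where `h a` is very close to `1 / R` modulo one. -/
theorem exists_clock {a : ℝ} (ha : Irrational a) {M R : ℕ} (hM : 0 < M) (hR : 2 ≤ R) {ε : ℝ}
    (hε : 0 < ε) : ∃ (c : UnitAddCircle → ℕ) (B : Set UnitAddCircle), Measurable c ∧
      (∀ t, c t < R) ∧ MeasurableSet B ∧ volume B ≤ ENNReal.ofReal (2 * M / R + ε) ∧
      ∀ t ∉ B, ∀ n : ℤ, |n| ≤ M → (c (t + ((n * a : ℝ) : UnitAddCircle)) : ℤ) = c t + n := by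
  have hR0 : (0 : ℝ) < R := by positivity
  have hM0 : (0 : ℝ) < M := by exact_mod_cast hM
  obtain ⟨ρ, hρ, hρε⟩ : ∃ ρ : ℝ, 0 < ρ ∧ (R + 1) * (2 * ρ / R) = ε :=
    ⟨ε * R / (2 * (R + 1)), by positivity, by field_simp⟩
  obtain ⟨h, e, hh, he, hhe⟩ := exists_zsmul_eq_inv_add ha hR (η := ρ / (R * M)) (by positivity)
  have hmp : MeasurePreserving (fun t : UnitAddCircle => h • t) :=
    Measure.measurePreserving_zsmul volume hh
  refine ⟨fun t => ⌊R * circleFract (h • t)⌋₊, (fun t => h • t) ⁻¹' nearGrid M R ρ, ?_, ?_,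
    hmp.measurable (measurableSet_nearGrid _ _ _), ?_, ?_⟩
  · exact Nat.measurable_floor.comp ((measurable_circleFract.comp hmp.measurable).const_mul _)
  · intro t
    have hf := circleFract_mem (h • t)
    rw [Nat.floor_lt (by have := hf.1; positivity)]
    nlinarith [hf.2]
  · rw [hmp.measure_preimage (measurableSet_nearGrid _ _ _).nullMeasurableSet, ← hρε]
    exact volume_nearGrid_le (by omega) hρ
  · intro t ht n hn
    simp only [mem_preimage, nearGrid, mem_ofPred_eq, not_or, not_lt, not_le, not_exists,
      not_and] at ht
    set x := circleFract (h • t) with hx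
    obtain ⟨ht₁, ht₂, ht₃⟩ := ht
    have hx0 := circleFract_mem (h • t)
    rw [← hx] at hx0
    have hRx : 0 ≤ R * x := mul_nonneg hR0.le hx0.1
    have hrot : h • (t + ((n * a : ℝ) : UnitAddCircle)) =
        ((x + n * (1 / R + e) : ℝ) : UnitAddCircle) := by
      have h₁ : ((n * a : ℝ) : UnitAddCircle) = n • (a : UnitAddCircle) := by
        rw [← AddCircle.coe_zsmul, zsmul_eq_mul]
      rw [smul_add, h₁, smul_comm h n, hhe, ← AddCircle.coe_zsmul, zsmul_eq_mul,
        AddCircle.coe_add, hx, coe_circleFract]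
    set j := ⌊R * x⌋₊ with hj
    have hj₁ : (j : ℝ) ≤ R * x := Nat.floor_le hRx
    have hj₂ : R * x < j + 1 := Nat.lt_floor_add_one _
    have hjM : M ≤ j := Nat.le_floor ht₁
    have hjR : j + M < R := by
      have : (j : ℝ) + M < R := by linarith
      exact_mod_cast this
    have hg₁ := ht₃ j (Finset.mem_range.mpr (by omega))
    have hg₂ := ht₃ (j + 1) (Finset.mem_range.mpr (by omega))
    push_cast at hg₂
    rw [abs_of_nonneg (by linarith)] at hg₁
    rw [abs_of_nonpos (by linarith)] at hg₂
    have hn' := abs_le.mp hn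
    have hdrift : |n * (R * e)| < ρ := by
      have hnR : |(n : ℝ)| ≤ M := by exact_mod_cast hn
      rw [abs_mul, abs_mul, abs_of_pos hR0]
      calc |(n : ℝ)| * (R * |e|) ≤ M * (R * |e|) := by gcongr
        _ < M * (R * (ρ / (R * M))) := by gcongr
        _ = ρ := by field_simp
    rw [abs_lt] at hdrift
    have hz : R * (x + n * (1 / R + e)) = R * x + n + n * (R * e) := by
      field_simp
      ring
    have hz₁ : ((j + n : ℤ) : ℝ) ≤ R * (x + n * (1 / R + e)) := by
      rw [hz]; push_cast; linarith
    have hz₂ : R * (x + n * (1 / R + e)) < ((j + n : ℤ) : ℝ) + 1 := by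
      rw [hz]; push_cast; linarith
    have hlo : (0 : ℝ) ≤ ((j + n : ℤ) : ℝ) := by exact_mod_cast (by omega : (0 : ℤ) ≤ j + n)
    have hhi : ((j + n : ℤ) : ℝ) + 1 ≤ R := by
      exact_mod_cast (by omega : (j + n : ℤ) + 1 ≤ R)
    have hmem : x + n * (1 / R + e) ∈ Ico (0 : ℝ) 1 := by
      constructor
      · exact nonneg_of_mul_nonneg_right (hlo.trans hz₁) hR0
      · by_contra! hc
        have : (R : ℝ) * 1 ≤ R * (x + n * (1 / R + e)) := by gcongr
        linarith
    simp only
    rw [hrot, circleFract_coe hmem, Int.natCast_floor_eq_floor (hlo.trans hz₁),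
      Int.floor_eq_iff]
    exact ⟨hz₁, hz₂⟩

/-- **Locally periodic orbits.** If `p a` is congruent to `δ` modulo one and `R |δ| ≤ ω p`, the
identity of the circle can be changed by at most `ω` so that along most orbits of the rotation by
`a` the resulting sequence has period exactly `p` for all times up to `M` in both directions: on
each run of the clock through its `R` values the drift `δ` is subtracted after every `p` steps. -/
theorem exists_locally_periodic_map {a δ ω ε : ℝ} (ha : Irrational a) {M R p : ℕ} (hM : 0 < M)
    (hR : 2 ≤ R) (hp : 0 < p) {z : ℤ} (hδ : p * a = δ + z) (hω : R * |δ| ≤ ω * p) (hε : 0 < ε) :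
    ∃ (φ : UnitAddCircle → UnitAddCircle) (B : Set UnitAddCircle), Measurable φ ∧
      (∀ t, dist (φ t) t ≤ ω) ∧ MeasurableSet B ∧ volume B ≤ ENNReal.ofReal (2 * M / R + ε) ∧
      ∀ t ∉ B, ∀ n : ℤ, -M ≤ n → n + p ≤ M →
        φ (t + (((n + p : ℤ) * a : ℝ) : UnitAddCircle))
          = φ (t + ((n * a : ℝ) : UnitAddCircle)) := by
  obtain ⟨c, B, hc, hcR, hB, hBm, hper⟩ := exists_clock ha hM hR hε
  have hp0 : (0 : ℝ) < p := by exact_mod_cast hp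
  refine ⟨fun t => t - (((c t / p : ℕ) * δ : ℝ) : UnitAddCircle), B, ?_, fun t => ?_, hB, hBm,
    fun t ht n hn₁ hn₂ => ?_⟩
  · exact measurable_id.sub
      ((measurable_of_countable fun k : ℕ => (((k / p : ℕ) * δ : ℝ) : UnitAddCircle)).comp hc)
  · rw [dist_eq_norm, sub_sub_cancel_left, norm_neg]
    refine (QuotientAddGroup.norm_mk_le_norm (S := AddSubgroup.zmultiples (1 : ℝ))).trans ?_
    rw [Real.norm_eq_abs, abs_mul, Nat.abs_cast]
    have h₁ : ((c t / p : ℕ) : ℝ) ≤ R / p :=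
      Nat.cast_div_le.trans (by gcongr; exact (hcR t).le)
    calc ((c t / p : ℕ) : ℝ) * |δ| ≤ R / p * |δ| := by gcongr
      _ = R * |δ| / p := by ring
      _ ≤ ω := by rwa [div_le_iff₀ hp0]
  · have h₁ := hper t ht (n + p) (abs_le.mpr ⟨by omega, by omega⟩)
    have h₀ := hper t ht n (abs_le.mpr ⟨by omega, by omega⟩)
    have h₂ : c (t + (((n + p : ℤ) * a : ℝ) : UnitAddCircle))
        = c (t + ((n * a : ℝ) : UnitAddCircle)) + p := by omega
    simp only [h₂, Nat.add_div_right _ hp]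
    set k := c (t + ((n * a : ℝ) : UnitAddCircle)) / p
    have h₃ : (((n + p : ℤ) * a : ℝ) : ℝ) - ((k + 1 : ℕ) : ℝ) * δ
        = n * a - k * δ + (z : ℤ) := by
      push_cast
      linear_combination hδ
    rw [add_sub_assoc, add_sub_assoc, ← AddCircle.coe_sub, ← AddCircle.coe_sub, h₃,
      AddCircle.coe_add _ (n * a - k * δ), coe_intCast_unitAddCircle, add_zero]

/-! ### Choice of the periods -/

/-- **Choice of the periods.** If `a` is not of bounded type, there are periods `p` for `a` and `q`
for `b`, and numbers `J`, `K` of repetitions, such that the drifts `δ`, `δ'` are still small after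
`L J` and `L K` repetitions, and yet the number `J K` of lattice points in the box of `J` by `K`
periods exceeds its boundary length by the factor `1 / η`. Here `p` comes from the good
approximations of `a`, and `q` from Dirichlet's theorem with a bound proportional to `p`. -/
theorem exists_periods_of_not_boundedType {a : ℝ} (ha : ¬ BoundedType a) (b : ℝ) {ω η : ℝ}
    (hω : 0 < ω) (hη : 0 < η) {L : ℕ} (hL : 0 < L) :
    ∃ (p q J K : ℕ) (δ δ' : ℝ) (z z' : ℤ), 0 < p ∧ 0 < q ∧ 0 < J ∧ 0 < K ∧
      p * a = δ + z ∧ q * b = δ' + z' ∧ L * J * |δ| ≤ ω ∧ L * K * |δ'| ≤ ω ∧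
      2 * (J * p + K * q : ℝ) ≤ η * (J * K) := by
  have hL0 : (0 : ℝ) < L := by exact_mod_cast hL
  set A : ℝ := 4 / η + 1 with hA
  have hA0 : 0 < A := by positivity
  set A' : ℝ := L * A / ω + 1 with hA'
  have hA'0 : 0 < A' := by positivity
  obtain ⟨p, z, hp, hpz⟩ := exists_nat_mul_abs_sub_le_of_not_boundedType ha
    (ε := ω / (L * A * A')) (by positivity)
  have hp1 : (1 : ℝ) ≤ p := by exact_mod_cast hp
  set N : ℕ := ⌈L * A * p / ω⌉₊ with hN
  have hN0 : 0 < N := Nat.ceil_pos.mpr (by positivity)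
  obtain ⟨q, hq, hqN, hqz⟩ := Real.exists_nat_abs_mul_sub_round_le b hN0
  have hq1 : (1 : ℝ) ≤ q := by exact_mod_cast hq
  -- a ceiling that loses at most the factor `A / (4 / η)`
  have hceil : ∀ m : ℕ, (1 : ℝ) ≤ m → 4 * m ≤ η * ⌈4 * m / η⌉₊ ∧ (⌈4 * m / η⌉₊ : ℝ) ≤ A * m := by
    intro m hm
    constructor
    · have := Nat.le_ceil (4 * m / η)
      rw [div_le_iff₀ hη] at this
      linarith
    · have := (Nat.ceil_lt_add_one (a := 4 * m / η) (by positivity)).le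
      have h : 4 * m / η + 1 ≤ A * m := by rw [hA]; ring_nf; linarith
      linarith
  obtain ⟨hK₁, hK₂⟩ := hceil p hp1
  obtain ⟨hJ₁, hJ₂⟩ := hceil q hq1
  set J := ⌈4 * q / η⌉₊
  set K := ⌈4 * p / η⌉₊
  have hqp : (q : ℝ) ≤ A' * p := by
    have h₁ : (q : ℝ) ≤ N := by exact_mod_cast hqN
    have h₂ := (Nat.ceil_lt_add_one (a := L * A * p / ω) (by positivity)).le
    have h₃ : L * A * p / ω + 1 ≤ A' * p := by rw [hA']; ring_nf; linarith
    linarith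
  refine ⟨p, q, J, K, p * a - z, q * b - round (q * b), z, round (q * b), hp, hq,
    Nat.ceil_pos.mpr (by positivity), Nat.ceil_pos.mpr (by positivity), by ring, by ring,
    ?_, ?_, ?_⟩
  · calc L * J * |p * a - z| ≤ L * (A * (A' * p)) * |p * a - z| := by
          gcongr
          exact hJ₂.trans (by gcongr)
      _ = L * A * A' * (p * |p * a - z|) := by ring
      _ ≤ L * A * A' * (ω / (L * A * A')) := by gcongr
      _ = ω := by field_simp
  · have hN' := Nat.le_ceil (L * A * p / ω)
    rw [div_le_iff₀ hω] at hN'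
    calc L * K * |q * b - round (q * b)| ≤ L * (A * p) * (1 / (N + 1)) := by gcongr
      _ ≤ ω := by
          rw [mul_one_div, div_le_iff₀ (by positivity)]
          linarith
  · nlinarith [mul_le_mul_of_nonneg_left hK₁ (Nat.cast_nonneg (α := ℝ) J),
      mul_le_mul_of_nonneg_left hJ₁ (Nat.cast_nonneg (α := ℝ) K)]

/-- The choice of periods with the roles of the two frequencies symmetric. -/
theorem exists_periods {α : Fin 2 → ℝ} (hα : ¬ (BoundedType (α 0) ∧ BoundedType (α 1)))
    {ω η : ℝ} (hω : 0 < ω) (hη : 0 < η) {L : ℕ} (hL : 0 < L) :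
    ∃ (p J : Fin 2 → ℕ) (δ : Fin 2 → ℝ) (z : Fin 2 → ℤ),
      (∀ i, 0 < p i ∧ 0 < J i ∧ p i * α i = δ i + z i ∧ L * J i * |δ i| ≤ ω) ∧
      2 * (J 0 * p 0 + J 1 * p 1 : ℝ) ≤ η * (J 0 * J 1) := by
  rcases not_and_or.mp hα with h | h
  · obtain ⟨p, q, J, K, δ, δ', z, z', h₁, h₂, h₃, h₄, h₅, h₆, h₇, h₈, h₉⟩ :=
      exists_periods_of_not_boundedType h (α 1) hω hη hL
    refine ⟨![p, q], ![J, K], ![δ, δ'], ![z, z'], ?_, by simpa using h₉⟩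
    simp [Fin.forall_fin_two, *]
  · obtain ⟨p, q, J, K, δ, δ', z, z', h₁, h₂, h₃, h₄, h₅, h₆, h₇, h₈, h₉⟩ :=
      exists_periods_of_not_boundedType h (α 0) hω hη hL
    refine ⟨![q, p], ![K, J], ![δ', δ], ![z', z], ?_, ?_⟩
    · simp [Fin.forall_fin_two, *]
    · simp only [Matrix.cons_val_zero, Matrix.cons_val_one]
      linarith

/-! ### Approximation by continuous functions -/

/-- A measurable function within uniform distance `s` of a continuous one is an almost everywhere
limit of continuous functions with the same property. -/
theorem exists_seq_continuousMap_tendsto_ae {X : Type*} [TopologicalSpace X] [NormalSpace X]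
    [MeasurableSpace X] [BorelSpace X] {μ : Measure X} [IsFiniteMeasure μ] [μ.WeaklyRegular]
    {f : X → ℝ} (hf : Measurable f) (g : C(X, ℝ)) {s : ℝ} (hs : 0 ≤ s)
    (hfg : ∀ x, |f x - g x| ≤ s) :
    ∃ h : ℕ → C(X, ℝ), (∀ k x, |h k x - g x| ≤ s) ∧
      ∀ᵐ x ∂μ, Tendsto (fun k => h k x) atTop (𝓝 (f x)) := by
  have hF : Measurable fun x => f x - g x := hf.sub g.continuous.measurable
  have hmem : MemLp (fun x => f x - g x) 1 μ :=
    MemLp.of_bound hF.aestronglyMeasurable s (.of_forall hfg)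
  have happ : ∀ k : ℕ, ∃ b : BoundedContinuousFunction X ℝ,
      eLpNorm ((fun x => f x - g x) - (b : X → ℝ)) 1 μ ≤ ((k : ENNReal) + 1)⁻¹ := fun k =>
    (hmem.exists_boundedContinuous_eLpNorm_sub_le ENNReal.one_ne_top (by simp)).imp
      fun b hb => hb.1
  choose b hb using happ
  have hlim : Tendsto (fun k => eLpNorm ((b k : X → ℝ) - fun x => f x - g x) 1 μ) atTop (𝓝 0) := by
    refine tendsto_of_tendsto_of_tendsto_of_le_of_le tendsto_const_nhds ?_
      (fun _ => zero_le) (fun k => (eLpNorm_sub_comm _ _ _ _).trans_le (hb k))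
    have := ENNReal.tendsto_inv_nat_nhds_zero.comp (tendsto_add_atTop_nat 1)
    simpa [Function.comp_def] using this
  obtain ⟨ns, -, hns⟩ := (tendstoInMeasure_of_tendsto_eLpNorm one_ne_zero
    (fun k => (b k).continuous.aestronglyMeasurable) hF.aestronglyMeasurable
    hlim).exists_seq_tendsto_ae
  refine ⟨fun k => ⟨fun x => g x + max (-s) (min s (b (ns k) x)), by fun_prop⟩, fun k x => ?_, ?_⟩
  · simp only [ContinuousMap.coe_mk, add_sub_cancel_left, abs_le]
    exact ⟨le_max_left _ _, max_le (by linarith) (min_le_left _ _)⟩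
  · filter_upwards [hns] with x hx
    have h := (tendsto_const_nhds (x := g x)).add
      ((tendsto_const_nhds (x := -s)).max ((tendsto_const_nhds (x := s)).min hx))
    have hx' := abs_le.mp (hfg x)
    rw [min_eq_right hx'.2, max_eq_right hx'.1, add_sub_cancel] at h
    exact h

/-! ### Orbit potentials and density -/

/-- The potential `n ↦ f (T^n x)` sampled along the orbit of `x`. -/
def orbitPotential (α : Fin 2 → ℝ) (f : Torus 2 → ℝ) (x : Torus 2) : (Fin 2 → ℤ) → ℝ :=
  fun n => f (torusShift α n x)

theorem measurePreserving_torusShift (α : Fin 2 → ℝ) (n : Fin 2 → ℤ) :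
    MeasurePreserving (torusShift α n) (volume : Measure (Torus 2)) volume :=
  measurePreserving_add_right volume fun i => (((n i : ℝ) * α i : ℝ) : UnitAddCircle)

theorem torusShift_torusShift (α : Fin 2 → ℝ) (m n : Fin 2 → ℤ) (x : Torus 2) :
    torusShift α m (torusShift α n x) = torusShift α (m + n) x := by
  ext i
  simp only [torusShift, Pi.add_apply]
  rw [add_assoc, ← AddCircle.coe_add]
  congr 2
  push_cast
  ring

theorem measurable_orbitPotential (α : Fin 2 → ℝ) {f : Torus 2 → ℝ} (hf : Measurable f) :
    Measurable (orbitPotential α f) :=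
  measurable_pi_lambda _ fun n => hf.comp (measurePreserving_torusShift α n).measurable

/-- The orbit potentials of a continuous function are concentrated on a small set only: an open
condition on the function. -/
theorem isOpen_setOf_measure_concentrated_lt (α : Fin 2 → ℝ) (c : ℝ) (ε : ENNReal) :
    IsOpen {f : C(Torus 2, ℝ) |
      volume (orbitPotential α f ⁻¹' concentratedPotentials c) < ε} := by
  rw [← isClosed_compl_iff]
  refine IsSeqClosed.isClosed fun f g hf hlim hg => ?_
  have hpt : ∀ᵐ x : Torus 2, Tendsto (fun k => orbitPotential α (f k) x) atTop
      (𝓝 (orbitPotential α g x)) := .of_forall fun x => tendsto_pi_nhds.mpr fun n =>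
    ((ContinuousEvalConst.continuous_eval_const (torusShift α n x)).tendsto g).comp hlim
  obtain ⟨k, hk⟩ := (eventually_measure_preimage_lt
    (fun k => measurable_orbitPotential α (f k).continuous.measurable) hpt
    (isClosed_concentratedPotentials c) hg).exists
  exact hf k hk

/-- A potential with periods in the two coordinate directions on a window of many periods, in
comparison with the lengths of the periods, is not concentrated. -/
theorem notMem_concentratedPotentials {p J : Fin 2 → ℕ} (hp : ∀ i, 0 < p i) (hJ : ∀ i, 0 < J i)
    {η c : ℝ} (hηc : η < c) (hbox : 2 * (J 0 * p 0 + J 1 * p 1 : ℝ) ≤ η * (J 0 * J 1)) (hc : 0 < c)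
    {V : (Fin 2 → ℤ) → ℝ}
    (hV₁ : ∀ s t : ℤ, -(J 0 * p 0 : ℤ) ≤ s → s + p 0 ≤ J 0 * p 0 → V ![s + p 0, t] = V ![s, t])
    (hV₂ : ∀ s t : ℤ, -(J 1 * p 1 : ℤ) ≤ t → t + p 1 ≤ J 1 * p 1 → V ![s, t + p 1] = V ![s, t]) :
    V ∉ concentratedPotentials c := by
  rintro ⟨u, hu, huc, he⟩
  have hu0 : u 0 ≠ 0 := by
    intro h
    rw [h] at huc
    simp at huc
    linarith
  have hJ0 : (0 : ℝ) < J 0 * J 1 := by exact_mod_cast Nat.mul_pos (hJ 0) (hJ 1)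
  have h := mul_norm_sq_le_of_periodic_window (hp 0) (hp 1) (hJ 0) (hJ 1)
    (V := fun s t => (V ![s, t] : ℂ)) (u := fun s t => u ![s, t])
    (E := latticeOp V u 0 / u 0) (fun s t => ?_)
    (fun s t h₁ h₂ => congrArg _ (hV₁ s t h₁ h₂)) (fun s t h₁ h₂ => congrArg _ (hV₂ s t h₁ h₂))
    (fun F => ?_)
  · have h00 : (![0, 0] : Fin 2 → ℤ) = 0 := by ext i; fin_cases i <;> rfl
    simp only [h00] at h
    have h₁ : (J 0 * J 1 : ℝ) * c ≤ J 0 * J 1 * ‖u 0‖ ^ 2 := by gcongr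
    nlinarith
  · have h := he ![s, t]
    have e₁ : (![s, t] : Fin 2 → ℤ) + Pi.single 0 1 = ![s + 1, t] := by
      ext i; fin_cases i <;> simp
    have e₂ : (![s, t] : Fin 2 → ℤ) - Pi.single 0 1 = ![s - 1, t] := by
      ext i; fin_cases i <;> simp
    have e₃ : (![s, t] : Fin 2 → ℤ) + Pi.single 1 1 = ![s, t + 1] := by
      ext i; fin_cases i <;> simp
    have e₄ : (![s, t] : Fin 2 → ℤ) - Pi.single 1 1 = ![s, t - 1] := by
      ext i; fin_cases i <;> simp
    have h' : latticeOp V u ![s, t] = latticeOp V u 0 / u 0 * u ![s, t] := by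
      field_simp
      linear_combination h
    rw [← h', latticeOp, Fin.sum_univ_two, e₁, e₂, e₃, e₄]
  · let φ : ℤ × ℤ ↪ (Fin 2 → ℤ) := ⟨fun i => ![i.1, i.2], fun i j hij =>
      Prod.ext (congrFun hij 0) (congrFun hij 1)⟩
    have h := hu (F.map φ)
    rw [Finset.sum_map] at h
    exact h

/-- **Density.** Near every continuous function there is one whose orbit potentials are mostly not
concentrated: compose it with locally periodic perturbations of the identity in both coordinates,
and smooth out the measurable function so obtained. -/
theorem dense_setOf_measure_concentrated_lt {α : Fin 2 → ℝ} (hirr : ∀ i, Irrational (α i))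
    (hα : ¬ (BoundedType (α 0) ∧ BoundedType (α 1))) {c : ℝ} (hc : 0 < c) {ε : ℝ} (hε : 0 < ε) :
    Dense {f : C(Torus 2, ℝ) |
      volume (orbitPotential α f ⁻¹' concentratedPotentials c) < ENNReal.ofReal ε} := by
  intro g
  rw [Metric.mem_closure_iff]
  intro r hr
  -- a modulus of continuity of `g`
  obtain ⟨ω', hω', hg⟩ := Metric.uniformContinuous_iff.mp
    (CompactSpace.uniformContinuous_of_continuous g.continuous) (r / 2) (by positivity)
  obtain ⟨ω, hω, hωω'⟩ : ∃ ω, 0 < ω ∧ ω < ω' := ⟨ω' / 2, by positivity, by linarith⟩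
  set L : ℕ := ⌈16 / ε⌉₊ + 2 with hL
  have hL0 : (0 : ℝ) < L := by positivity
  have hLε : 2 / (L : ℝ) ≤ ε / 8 := by
    have h₁ := Nat.le_ceil (16 / ε)
    have h₂ : (L : ℝ) = ⌈16 / ε⌉₊ + 2 := by rw [hL]; push_cast; ring
    have h₃ : 16 / ε ≤ L := by linarith
    rw [div_le_iff₀ hε] at h₃
    rw [div_le_iff₀ hL0]
    linarith
  obtain ⟨p, J, δ, z, hpJ, hbox⟩ := exists_periods hα hω (half_pos hc) (L := L) (by omega)
  -- the window has length `J i * p i`, and the clock runs for `L` windows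
  have hφ : ∀ i, ∃ (φ : UnitAddCircle → UnitAddCircle) (B : Set UnitAddCircle), Measurable φ ∧
      (∀ t, dist (φ t) t ≤ ω) ∧ MeasurableSet B ∧
      volume B ≤ ENNReal.ofReal (ε / 4) ∧
      ∀ t ∉ B, ∀ n : ℤ, -(J i * p i : ℕ) ≤ n → n + p i ≤ (J i * p i : ℕ) →
        φ (t + (((n + p i : ℤ) * α i : ℝ) : UnitAddCircle))
          = φ (t + ((n * α i : ℝ) : UnitAddCircle)) := by
    intro i
    obtain ⟨hp, hJ, hδ, hdrift⟩ := hpJ i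
    have hM : 0 < J i * p i := Nat.mul_pos hJ hp
    obtain ⟨φ, B, h₁, h₂, h₃, h₄, h₅⟩ := exists_locally_periodic_map (hirr i) (M := J i * p i)
      (R := L * (J i * p i)) (ω := ω) (ε := ε / 8) hM (by nlinarith) hp hδ (by
        have hp0 : (0 : ℝ) < p i := by exact_mod_cast hp
        push_cast
        calc (L * (J i * p i) * |δ i| : ℝ) = L * J i * |δ i| * p i := by ring
          _ ≤ ω * p i := by gcongr) (by positivity)
    refine ⟨φ, B, h₁, h₂, h₃, h₄.trans (ENNReal.ofReal_le_ofReal ?_), h₅⟩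
    have hM0 : (0 : ℝ) < (J i * p i : ℕ) := by exact_mod_cast hM
    have e : 2 * ((J i * p i : ℕ) : ℝ) / ((L * (J i * p i) : ℕ) : ℝ) = 2 / L := by
      rw [Nat.cast_mul L]
      field_simp
    rw [e]
    linarith
  choose φ B hφm hφd hBm hB hφp using hφ
  let f : Torus 2 → ℝ := fun x => g fun i => φ i (x i)
  have hfm : Measurable f := g.continuous.measurable.comp
    (measurable_pi_lambda _ fun i => (hφm i).comp (measurable_pi_apply i))
  have hfg : ∀ x, |f x - g x| ≤ r / 2 := fun x => by
    rw [← Real.dist_eq]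
    exact (hg (((dist_pi_le_iff hω.le).mpr fun i => hφd i _).trans_lt hωω')).le
  have hgood : orbitPotential α f ⁻¹' concentratedPotentials c ⊆
      ⋃ i, (fun x : Torus 2 => x i) ⁻¹' B i := by
    intro x hx
    by_contra hxB
    simp only [mem_iUnion, mem_preimage, not_exists] at hxB
    refine notMem_concentratedPotentials (fun i => (hpJ i).1) (fun i => (hpJ i).2.1)
      (half_lt_self hc) hbox hc (fun s t h₁ h₂ => ?_) (fun s t h₁ h₂ => ?_) hx
    · refine congrArg g (funext fun i => ?_)
      fin_cases i
      · exact hφp 0 _ (hxB 0) s (by push_cast; linarith) (by push_cast; linarith)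
      · rfl
    · refine congrArg g (funext fun i => ?_)
      fin_cases i
      · rfl
      · exact hφp 1 _ (hxB 1) t (by push_cast; linarith) (by push_cast; linarith)
  have hfε : volume (orbitPotential α f ⁻¹' concentratedPotentials c) < ENNReal.ofReal ε := by
    refine ((measure_mono hgood).trans (measure_iUnion_le _)).trans_lt ?_
    rw [tsum_fintype]
    calc ∑ i, volume ((fun x : Torus 2 => x i) ⁻¹' B i)
        ≤ ∑ _i : Fin 2, ENNReal.ofReal (ε / 4) := Finset.sum_le_sum fun i _ => by
          have : IsProbabilityMeasure (volume : Measure UnitAddCircle) :=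
            ⟨by simp⟩
          have he : MeasurePreserving (fun x : Torus 2 => x i) volume volume :=
            measurePreserving_eval (fun _ : Fin 2 => (volume : Measure UnitAddCircle)) i
          rw [he.measure_preimage (hBm i).nullMeasurableSet]
          exact hB i
      _ = ENNReal.ofReal (ε / 2) := by
          rw [Fin.sum_univ_two, ← ENNReal.ofReal_add (by positivity) (by positivity)]
          congr 1; ring
      _ < ENNReal.ofReal ε := (ENNReal.ofReal_lt_ofReal_iff hε).mpr (by linarith)
  obtain ⟨h, hhg, hlim⟩ := exists_seq_continuousMap_tendsto_ae (μ := (volume : Measure (Torus 2)))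
    hfm g (by positivity) hfg
  have hpt : ∀ᵐ x : Torus 2, Tendsto (fun k => orbitPotential α (h k) x) atTop
      (𝓝 (orbitPotential α f x)) := by
    have hall : ∀ᵐ x : Torus 2, ∀ n : Fin 2 → ℤ,
        Tendsto (fun k => h k (torusShift α n x)) atTop (𝓝 (f (torusShift α n x))) :=
      ae_all_iff.mpr fun n => (measurePreserving_torusShift α n).quasiMeasurePreserving.ae hlim
    filter_upwards [hall] with x hx
    exact tendsto_pi_nhds.mpr hx
  obtain ⟨k, hk⟩ := (eventually_measure_preimage_lt
    (fun k => measurable_orbitPotential α (h k).continuous.measurable) hpt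
    (isClosed_concentratedPotentials c) hfε).exists
  refine ⟨h k, hk, ?_⟩
  rw [dist_comm]
  refine lt_of_le_of_lt ((ContinuousMap.dist_le (by positivity)).mpr fun x => ?_) (half_lt_self hr)
  rw [Real.dist_eq]
  exact hhg k x

/-! ### Absence of eigenvalues -/

theorem latticeOp_orbitPotential_translate {α : Fin 2 → ℝ} {f : Torus 2 → ℝ} {x : Torus 2}
    {E : ℂ} {v : (Fin 2 → ℤ) → ℂ} (hv : ∀ k, latticeOp (orbitPotential α f x) v k = E * v k)
    (n : Fin 2 → ℤ) (r : ℂ) (k : Fin 2 → ℤ) :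
    latticeOp (orbitPotential α f (torusShift α n x)) (fun k => v (k + n) / r) k
      = E * (v (k + n) / r) := by
  have h := hv (k + n)
  simp only [latticeOp, orbitPotential, torusShift_torusShift] at h ⊢
  simp only [← mul_div_assoc]
  rw [← h, add_div, Finset.sum_div]
  congr 1
  refine Finset.sum_congr rfl fun i _ => ?_
  rw [← add_div, add_right_comm, sub_add_eq_add_sub]

/-- Normalising and translating an eigenvector shows that some orbit potential is concentrated. -/
theorem exists_concentrated_of_hasEigenvalue {α : Fin 2 → ℝ} {f : C(Torus 2, ℝ)} {x : Torus 2}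
    {E : ℂ} (hE : Module.End.HasEigenvalue
      (schrodingerOp α f x : LatticeL2 2 →ₗ[ℂ] LatticeL2 2) E) :
    ∃ (n : Fin 2 → ℤ) (m : ℕ),
      orbitPotential α f (torusShift α n x) ∈ concentratedPotentials (1 / (m + 1)) := by
  obtain ⟨u, hu⟩ := hE.exists_hasEigenvector
  have hu0 : u ≠ 0 := hu.2
  have hnorm : 0 < ‖u‖ := norm_pos_iff.mpr hu0
  obtain ⟨n, hn⟩ : ∃ n, u n ≠ 0 := by
    by_contra! h
    exact hu0 (lp.ext (funext h))
  have hEu : ∀ k, latticeOp (orbitPotential α f x) u k = E * u k := fun k => by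
    have h : schrodingerOp α f x u = E • u := hu.apply_eq_smul
    have h' := congrArg (fun v : LatticeL2 2 => v k) h
    simp only at h'
    rw [schrodingerOp_apply'] at h'
    simpa [latticeOp, orbitPotential] using h'
  let w : (Fin 2 → ℤ) → ℂ := fun k => u (k + n) / (‖u‖ : ℂ)
  have hw0 : 0 < ‖w 0‖ ^ 2 := by
    have : w 0 ≠ 0 := by
      simp only [w, zero_add]
      exact div_ne_zero hn (by exact_mod_cast hnorm.ne')
    positivity
  obtain ⟨m, hm⟩ := exists_nat_one_div_lt hw0
  have hw : ∀ k, latticeOp (orbitPotential α f (torusShift α n x)) w k = E * w k :=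
    latticeOp_orbitPotential_translate hEu n _
  refine ⟨n, m, w, fun F => ?_, hm.le, fun k => by rw [hw, hw]; ring⟩
  have h2 : (0 : ℝ) < (2 : ENNReal).toReal := by norm_num
  have h := lp.sum_rpow_le_norm_rpow h2 u (F.map (Equiv.addRight n).toEmbedding)
  simp only [Finset.sum_map, ENNReal.toReal_ofNat, Real.rpow_ofNat] at h
  have hwk : ∀ k, ‖w k‖ ^ 2 = ‖u (k + n)‖ ^ 2 / ‖u‖ ^ 2 := fun k => by
    simp [w, div_pow]
  simp only [hwk]
  rw [← Finset.sum_div, div_le_one (by positivity)]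
  exact h

theorem theorem1p1 (α : Fin 2 → ℝ) (hirr : ∀ i, Irrational (α i))
    (hα : ¬ (BoundedType (α 0) ∧ BoundedType (α 1))) :
    ∃ 𝓕 : Set C(Torus 2, ℝ), IsGδ 𝓕 ∧ Dense 𝓕 ∧
      ∀ f ∈ 𝓕, ∀ᵐ x : Torus 2 ∂MeasureTheory.volume, ∀ E : ℂ,
        ¬ Module.End.HasEigenvalue
          (schrodingerOp α f x : LatticeL2 2 →ₗ[ℂ] LatticeL2 2) E := by
  let U : ℕ × ℕ → Set C(Torus 2, ℝ) := fun i => {f |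
    volume (orbitPotential α f ⁻¹' concentratedPotentials (1 / (i.1 + 1)))
      < ENNReal.ofReal (1 / (i.2 + 1))}
  have hUo : ∀ i, IsOpen (U i) := fun i => isOpen_setOf_measure_concentrated_lt α _ _
  have hUd : ∀ i, Dense (U i) := fun i =>
    dense_setOf_measure_concentrated_lt hirr hα (by positivity) (by positivity)
  have : BaireSpace C(Torus 2, ℝ) := .of_completelyPseudoMetrizable
  refine ⟨⋂ i, U i, IsGδ.iInter_of_isOpen hUo, dense_iInter_of_isOpen hUo hUd, fun f hf => ?_⟩
  rw [mem_iInter] at hf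
  have hnull : ∀ m : ℕ,
      volume (orbitPotential α f ⁻¹' concentratedPotentials (1 / (m + 1))) = 0 := fun m => by
    have hlim : Tendsto (fun k : ℕ => ENNReal.ofReal (1 / (k + 1))) atTop (𝓝 0) := by
      simpa using ENNReal.tendsto_ofReal tendsto_one_div_add_atTop_nhds_zero_nat
    exact le_antisymm (ge_of_tendsto' hlim fun k => (hf (m, k)).le) zero_le
  have hae : ∀ᵐ x : Torus 2, ∀ (n : Fin 2 → ℤ) (m : ℕ),
      orbitPotential α f (torusShift α n x) ∉ concentratedPotentials (1 / (m + 1)) :=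
    ae_all_iff.mpr fun n => ae_all_iff.mpr fun m =>
      (measurePreserving_torusShift α n).quasiMeasurePreserving.ae
        (measure_eq_zero_iff_ae_notMem.mp (hnull m))
  filter_upwards [hae] with x hx E hE
  obtain ⟨n, m, h⟩ := exists_concentrated_of_hasEigenvalue hE
  exact hx n m h
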